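/- Let $n\ge 1$ and let $\delta_n=(n-1,n-2,\dots,2,1)$. A partition $\mu=(\mu_1\ge\mu_2\ge\cdots)$ (possibly empty) is identified with the set of positions $(i,j)$, $1\le j\le\mu_i$, and containment of partitions is containment of these sets. For a partition $\mu\subseteq\delta_n$ let $M^\mu$ be the $n\times n$ matrix with entry $1$ at $(1,\mu_1+1)$, with entries $1$ at $(k+1,\mu_{k+1}+1)$ and $-1$ at $(k+1,\mu_k+1)$ for each $1\le k\le n-1$ with $\mu_k>\mu_{k+1}$, and with all other entries $0$. For a partition $\lambda\subseteq\delta_n$ let $\mathrm{PASM}(\delta_n/\lambda,n,n)\subset\mathbb{R}^{n\times n}$ be the convex hull of the matrices $M^\mu$ with $\lambda\subseteq\mu\subseteq\delta_n$. An alternating sign matrix is an $n\times n$ matrix with entries in $\{-1,0,1\}$ such that $\sum_{i'=1}^{i}M_{i'j}\in\{0,1\}$ and $\sum_{j'=1}^{j}M_{ij'}\in\{0,1\}$ for all $1\le i,j\le n$, and such that every row and every column sums to $1$. Let $\mathrm{ASM}(n)\subset\mathbb{R}^{n\times n}$ be the convex hull of the alternating sign matrices, and let $$\mathrm{ASMCRY}(\lambda,n)=\{A\in\mathrm{ASM}(n)\;:\;A_{ij}=0\text{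 whenever } i+j\ge n+3\text{ or }(i,j)\in\lambda\}.$$ An integer polytope is the convex hull of a finite set of integer points. An integral equivalence from an integer polytope $P\subset\mathbb{R}^d$ to an integer polytope $Q\subset\mathbb{R}^r$ is an affine map $f:\mathbb{R}^d\to\mathbb{R}^r$ that maps $P$ bijectively onto $Q$ and maps $\mathbb{Z}^d\cap\mathrm{aff}(P)$ bijectively onto $\mathbb{Z}^r\cap\mathrm{aff}(Q)$, where $\mathrm{aff}$ denotes the affine span. **Theorem.** For every $n\ge1$ and every partition $\lambda\subseteq\delta_n$, both $\mathrm{PASM}(\delta_n/\lambda,n,n)$ and $\mathrm{ASMCRY}(\lambda,n)$ are integer polytopes, and the translation $\varphi:\mathbb{R}^{n\times n}\to\mathbb{R}^{n\times n}$ given by $$\varphi(M)_{ij}=\begin{cases}M_{ij}+1&\text{if } j=n-i+2,\\ M_{ij}&\text{otherwise}\end{cases}$$ is an integral equivalence from $\mathrm{PASM}(\delta_n/\lambda,n,n)$ to $\mathrm{ASMCRY}(\lambda,n)$. -/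

import Mathlib

/- Partitions are Mathlib's Young diagrams (English convention, boxes indexed from zero): the part
`μ_{i+1}` is `μ.rowLen i`, the box in row `i+1` and column `j+1` is `(i, j) ∈ μ`, and containment of
partitions is `≤`. Rows and columns of matrices are likewise indexed from zero by `Fin`. -/

/-- The staircase partition `δ_n = (n-1, n-2, …, 2, 1)`: the boxes `(i, j)` with `i + j + 2 ≤ n`
(zero-based). -/
def staircase (n : ℕ) : YoungDiagram where
  cells := (Finset.range n ×ˢ Finset.range n).filter fun c => c.1 + c.2 + 2 ≤ n
  isLowerSet := by
    rintro ⟨a, b⟩ ⟨c, d⟩ h hab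
    obtain ⟨h1, h2⟩ : c ≤ a ∧ d ≤ b := h
    simp only [Finset.coe_filter, Finset.mem_product, Finset.mem_range, Set.mem_ofPred_eq] at hab ⊢
    omega

theorem mem_staircase {n i j : ℕ} : (i, j) ∈ staircase n ↔ i + j + 2 ≤ n := by
  rw [← YoungDiagram.mem_cells]
  simp only [staircase, Finset.mem_filter, Finset.mem_product, Finset.mem_range]
  omega

/-- The `m × n` matrix `M^μ(m, n)` of a partition `μ` contained in `(n-1)^(m-1)`. With one-based
indices: `1` at `(1, μ_1 + 1)`; whenever `1 ≤ k ≤ m - 1` and `μ_k > μ_{k+1}`, `1` at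
`(k+1, μ_{k+1} + 1)` and `-1` at `(k+1, μ_k + 1)`; all other entries `0`. -/
noncomputable def partitionMatrix (μ : YoungDiagram) (m n : ℕ) : Matrix (Fin m) (Fin n) ℝ :=
  Matrix.of fun i j =>
    if (i : ℕ) = 0 ∧ (j : ℕ) = μ.rowLen 0 then 1
    else if 1 ≤ (i : ℕ) ∧ (j : ℕ) = μ.rowLen i ∧ μ.rowLen i < μ.rowLen (i - 1) then 1
    else if 1 ≤ (i : ℕ) ∧ (j : ℕ) = μ.rowLen (i - 1) ∧ μ.rowLen i < μ.rowLen (i - 1) then -1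
    else 0

/-- The `(ν/lam)`-partial ASM polytope `PASM(ν/lam, m, n)`, for `lam ⊆ ν ⊆ (n-1)^(m-1)`. -/
noncomputable def PASMPolytope (ν lam : YoungDiagram) (m n : ℕ) : Set (Matrix (Fin m) (Fin n) ℝ) :=
  convexHull ℝ {M | ∃ μ : YoungDiagram, lam ≤ μ ∧ μ ≤ ν ∧ M = partitionMatrix μ m n}

/-- Alternating sign matrices, as real matrices. -/
structure IsASM {n : ℕ} (M : Matrix (Fin n) (Fin n) ℝ) : Prop where
  entry : ∀ i j, M i j ∈ ({-1, 0, 1} : Set ℝ)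
  colPartial : ∀ i j, ∑ i' ∈ Finset.Iic i, M i' j ∈ ({0, 1} : Set ℝ)
  rowPartial : ∀ i j, ∑ j' ∈ Finset.Iic j, M i j' ∈ ({0, 1} : Set ℝ)
  colSum : ∀ j, ∑ i, M i j = 1
  rowSum : ∀ i, ∑ j, M i j = 1

/-- The alternating sign matrix polytope `ASM(n)`. -/
noncomputable def ASMPolytope (n : ℕ) : Set (Matrix (Fin n) (Fin n) ℝ) :=
  convexHull ℝ {M | IsASM M}

/-- The polytope `ASMCRY(lam, n)`. The condition `i + j ≥ n + 3` on one-based indices reads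
`n + 1 ≤ i + j` on zero-based ones. -/
noncomputable def ASMCRYPolytope (lam : YoungDiagram) (n : ℕ) : Set (Matrix (Fin n) (Fin n) ℝ) :=
  {A | A ∈ ASMPolytope n ∧
    ∀ i j : Fin n, n + 1 ≤ (i : ℕ) + j ∨ ((i : ℕ), (j : ℕ)) ∈ lam → A i j = 0}

/-- The lattice of integer points in the space of real matrices. -/
def integerMatrices (m n : ℕ) : Set (Matrix (Fin m) (Fin n) ℝ) :=
  {A | ∀ i j, ∃ z : ℤ, A i j = z}

/-- Integer polytopes: convex hulls of finite sets of integer points. -/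
def IsIntegerPolytope {m n : ℕ} (P : Set (Matrix (Fin m) (Fin n) ℝ)) : Prop :=
  ∃ V : Set (Matrix (Fin m) (Fin n) ℝ), V.Finite ∧ V ⊆ integerMatrices m n ∧ P = convexHull ℝ V

/-- The affine map `f` is an integral equivalence from the integer polytope `P` to the integer
polytope `Q`: it maps `P` bijectively onto `Q`, and the integer points of the affine span of `P`
bijectively onto those of the affine span of `Q`. -/
structure IsIntegralEquivalence {m n m' n' : ℕ}
    (f : Matrix (Fin m) (Fin n) ℝ →ᵃ[ℝ] Matrix (Fin m') (Fin n') ℝ)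
    (P : Set (Matrix (Fin m) (Fin n) ℝ)) (Q : Set (Matrix (Fin m') (Fin n') ℝ)) : Prop where
  source_integer : IsIntegerPolytope P
  target_integer : IsIntegerPolytope Q
  bijOn : Set.BijOn f P Q
  bijOn_lattice : Set.BijOn f
    (integerMatrices m n ∩ (affineSpan ℝ P : Set (Matrix (Fin m) (Fin n) ℝ)))
    (integerMatrices m' n' ∩ (affineSpan ℝ Q : Set (Matrix (Fin m') (Fin n') ℝ)))

/-- The translation `φ` adding `1` to the entries with `j = n - i + 2` (one-based indices; on
zero-based ones this is `i + j = n`) and leaving all other entries unchanged. -/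
noncomputable def antidiagonalTranslation (n : ℕ) :
    Matrix (Fin n) (Fin n) ℝ →ᵃ[ℝ] Matrix (Fin n) (Fin n) ℝ where
  toFun M := Matrix.of fun i j => if (i : ℕ) + j = n then M i j + 1 else M i j
  linear := LinearMap.id
  map_vadd' M v := by
    ext i j
    simp only [Matrix.of_apply, vadd_eq_add, Matrix.add_apply, LinearMap.id_apply]
    split_ifs <;> ring

/-!
A matrix is determined by its corner sums, i.e. the sums of its upper left blocks, and the corner
sums of `partitionMatrix μ` are the indicator of the complement of `μ`. If the corner sums of `M`
are monotone, take values in `[0, 1]`, vanish on `lam` and equal `1` off `ν`, then their sublevel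
sets at the levels `t ∈ (0, 1]` are partitions between `lam` and `ν`. A function with values in
`[0, 1]` is the average over `t` of the indicators of its superlevel sets, so `M` is an average of
partition matrices. For `φ M ∈ ASMCRY(lam, n)` these conditions hold: the zeros below the
antidiagonal force the corner sum of `φ M` over an `a × b` block with `n < a + b` to be `a + b - n`,
and subtracting the corner sum `a + b - n - 1` of the added antidiagonal leaves `1`.

Conversely, for `μ` inside the staircase, row `i > 0` (counted from zero) of `φ (partitionMatrix μ)`
is a `1` in column `μ.rowLen i`, a `-1` in column `μ.rowLen (i - 1)` and a `1` in column `n - i`,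
while row `0` is a single `1`. These three columns are weakly increasing, so every row has
alternating signs; columns follow by transposition.
-/

section Development

open Finset Matrix

/-! ### Corner sums -/

theorem eq_of_sum_Iic_eq {α G : Type*} [PartialOrder α] [LocallyFiniteOrderBot α] [WellFoundedLT α]
    [AddCancelCommMonoid G] {f g : α → G} (h : ∀ a, ∑ x ∈ Iic a, f x = ∑ x ∈ Iic a, g x) :
    f = g := by
  funext a
  induction a using WellFoundedLT.induction with
  | ind a ih =>
    have hlt : ∑ x ∈ Iio a, f x = ∑ x ∈ Iio a, g x :=
      sum_congr rfl fun x hx => ih x (mem_Iio.1 hx)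
    have ha := h a
    rw [← sum_Iio_add_eq_sum_Iic, ← sum_Iio_add_eq_sum_Iic, hlt] at ha
    exact add_left_cancel ha

theorem sum_Iic_val {n : ℕ} {G : Type*} [AddCommMonoid G] (f : ℕ → G) (i : Fin n) :
    ∑ k ∈ Iic i, f k = ∑ k ∈ range (i + 1), f k := by
  rw [Nat.range_succ_eq_Iic, ← Fin.map_valEmbedding_Iic, sum_map]
  rfl

theorem sum_Iic_ite_val_eq {n : ℕ} {R : Type*} [AddCommMonoidWithOne R] (r : ℕ) (j : Fin n) :
    ∑ k ∈ Iic j, (if (k : ℕ) = r then (1 : R) else 0) = if r ≤ j then 1 else 0 := by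
  rw [sum_Iic_val fun k => if k = r then (1 : R) else 0]
  simp only [sum_ite_eq', mem_range, Nat.lt_succ_iff]

theorem sum_univ_ite_val_eq {n : ℕ} {R : Type*} [AddCommMonoidWithOne R] (r : ℕ) :
    ∑ k : Fin n, (if (k : ℕ) = r then (1 : R) else 0) = if r < n then 1 else 0 := by
  rw [Fin.sum_univ_eq_sum_range fun k => if k = r then (1 : R) else 0]
  simp only [sum_ite_eq', mem_range]

theorem sum_Iic_sub_pred {n : ℕ} {G : Type*} [AddCommGroup G] (F : ℕ → G) (i : Fin n) :
    ∑ k ∈ Iic i, (F k - if 0 < (k : ℕ) then F (k - 1) else 0) = F i := by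
  rw [sum_Iic_val fun k => F k - if 0 < k then F (k - 1) else 0, sum_range_succ']
  simp only [Nat.succ_pos, if_true, Nat.add_sub_cancel, lt_irrefl, if_false, sub_zero]
  rw [sum_range_sub, sub_add_cancel]

section CornerSum

variable {ι κ R : Type*} [PartialOrder ι] [LocallyFiniteOrderBot ι]
  [PartialOrder κ] [LocallyFiniteOrderBot κ]

/-- The corner sums of a matrix, as a linear function of the matrix: the value at `(i, j)` is the
sum of the entries in the upper left block ending, inclusively, in row `i` and column `j`. -/
def cornerSum [Semiring R] : Matrix ι κ R →ₗ[R] ι × κ → R where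
  toFun A p := ∑ i ∈ Iic p.1, ∑ j ∈ Iic p.2, A i j
  map_add' A B := by
    funext p
    simp only [Matrix.add_apply, Pi.add_apply, sum_add_distrib]
  map_smul' c A := by
    funext p
    simp only [Matrix.smul_apply, Pi.smul_apply, mul_sum, smul_eq_mul, RingHom.id_apply]

theorem cornerSum_apply [Semiring R] (A : Matrix ι κ R) (p : ι × κ) :
    cornerSum A p = ∑ i ∈ Iic p.1, ∑ j ∈ Iic p.2, A i j :=
  rfl

theorem cornerSum_transpose [Semiring R] (A : Matrix ι κ R) (p : κ × ι) :
    cornerSum Aᵀ p = cornerSum A p.swap :=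
  sum_comm

theorem cornerSum_injective [WellFoundedLT ι] [WellFoundedLT κ] [Ring R] :
    Function.Injective (cornerSum : Matrix ι κ R →ₗ[R] ι × κ → R) := by
  intro A B h
  have hcol (j : κ) : (fun i => ∑ j' ∈ Iic j, A i j') = fun i => ∑ j' ∈ Iic j, B i j' :=
    eq_of_sum_Iic_eq fun i => congrFun h (i, j)
  exact funext fun i => eq_of_sum_Iic_eq fun j => congrFun (hcol j) i

variable [Semiring R] [PartialOrder R] [IsOrderedAddMonoid R] {A : Matrix ι κ R}

theorem cornerSum_nonneg (hrow : ∀ i j, 0 ≤ ∑ j' ∈ Iic j, A i j') (p : ι × κ) :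
    0 ≤ cornerSum A p :=
  sum_nonneg fun i _ => hrow i p.2

theorem cornerSum_mono (hrow : ∀ i j, 0 ≤ ∑ j' ∈ Iic j, A i j')
    (hcol : ∀ i j, 0 ≤ ∑ i' ∈ Iic i, A i' j) : Monotone (cornerSum A) := by
  rintro ⟨i, j⟩ ⟨i', j'⟩ ⟨hi, hj⟩
  calc cornerSum A (i, j)
      ≤ cornerSum A (i', j) :=
        sum_le_sum_of_subset_of_nonneg (Iic_subset_Iic.2 hi) fun k _ _ => hrow k j
    _ = ∑ l ∈ Iic j, ∑ k ∈ Iic i', A k l := sum_comm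
    _ ≤ ∑ l ∈ Iic j', ∑ k ∈ Iic i', A k l :=
        sum_le_sum_of_subset_of_nonneg (Iic_subset_Iic.2 hj) fun l _ _ => hcol i' l
    _ = cornerSum A (i', j') := sum_comm

end CornerSum

theorem cornerSum_eq_of_forall_gt_eq_zero {n : ℕ} {R : Type*} [Ring R]
    {A : Matrix (Fin n) (Fin n) R} (hrow : ∀ i, ∑ j, A i j = 1) (hcol : ∀ j, ∑ i, A i j = 1)
    {i j : Fin n} (hzero : ∀ i' > i, ∀ j' > j, A i' j' = 0) :
    cornerSum A (i, j) = (i + 1 : R) + (j + 1) - n := by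
  have hcompl (k : Fin n) : (Iic k)ᶜ = Ioi k := by
    ext
    simp only [mem_compl, mem_Iic, mem_Ioi, not_le]
  have hrow_split (i' : Fin n) : ∑ j' ∈ Iic j, A i' j' = 1 - ∑ j' ∈ Ioi j, A i' j' := by
    rw [← hrow i', ← sum_add_sum_compl (Iic j), hcompl, add_sub_cancel_right]
  have hcol_split {j' : Fin n} (hj' : j' ∈ Ioi j) : ∑ i' ∈ Iic i, A i' j' = 1 := by
    rw [← hcol j', ← sum_add_sum_compl (Iic i), hcompl,
      sum_eq_zero (s := Ioi i) fun i' hi' => hzero i' (mem_Ioi.1 hi') j' (mem_Ioi.1 hj'), add_zero]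
  calc cornerSum A (i, j)
      = ∑ i' ∈ Iic i, (1 - ∑ j' ∈ Ioi j, A i' j') := sum_congr rfl fun i' _ => hrow_split i'
    _ = (i + 1 : R) - ∑ j' ∈ Ioi j, ∑ i' ∈ Iic i, A i' j' := by
        rw [sum_sub_distrib, sum_comm, sum_const, Fin.card_Iic, nsmul_one, Nat.cast_add_one]
    _ = (i + 1 : R) - (n - (j + 1) : ℕ) := by
        rw [sum_congr rfl fun j' => hcol_split, sum_const, Fin.card_Ioi, nsmul_one, Nat.sub_sub,
          add_comm 1]
    _ = (i + 1 : R) + (j + 1) - n := by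
        rw [Nat.cast_sub (by omega), Nat.cast_add_one]
        abel

/-! ### Partition matrices -/

theorem partitionMatrix_apply (μ : YoungDiagram) {m n : ℕ} (i : Fin m) (j : Fin n) :
    partitionMatrix μ m n i j =
      (if (j : ℕ) = μ.rowLen i then 1 else 0) -
        if 0 < (i : ℕ) then (if (j : ℕ) = μ.rowLen (i - 1) then 1 else 0) else 0 := by
  have hanti := μ.rowLen_anti (i - 1) i (Nat.sub_le _ _)
  simp only [partitionMatrix, Matrix.of_apply]
  rcases Nat.eq_zero_or_pos (i : ℕ) with hi | hi
  · simp [hi]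
  · split_ifs <;> first | omega | norm_num

theorem partitionMatrix_mem_integerMatrices (μ : YoungDiagram) (m n : ℕ) :
    partitionMatrix μ m n ∈ integerMatrices m n := by
  intro i j
  simp only [partitionMatrix, Matrix.of_apply]
  split_ifs
  exacts [⟨1, by simp⟩, ⟨1, by simp⟩, ⟨-1, by simp⟩, ⟨0, by simp⟩]

theorem sum_Iic_partitionMatrix (μ : YoungDiagram) {m n : ℕ} (i : Fin m) (j : Fin n) :
    ∑ j' ∈ Iic j, partitionMatrix μ m n i j' =
      (if μ.rowLen i ≤ j then 1 else 0) -
        if 0 < (i : ℕ) then (if μ.rowLen (i - 1) ≤ j then 1 else 0) else 0 := by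
  simp only [partitionMatrix_apply, sum_sub_distrib, sum_Iic_ite_val_eq]
  by_cases hi : 0 < (i : ℕ)
  · simp only [hi, if_true, sum_Iic_ite_val_eq]
  · simp only [hi, if_false, sum_const_zero]

theorem sum_partitionMatrix (μ : YoungDiagram) {m n : ℕ} (i : Fin m) :
    ∑ j, partitionMatrix μ m n i j =
      (if μ.rowLen i < n then 1 else 0) -
        if 0 < (i : ℕ) then (if μ.rowLen (i - 1) < n then 1 else 0) else 0 := by
  simp only [partitionMatrix_apply, sum_sub_distrib, sum_univ_ite_val_eq]
  by_cases hi : 0 < (i : ℕ)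
  · simp only [hi, if_true, sum_univ_ite_val_eq]
  · simp only [hi, if_false, sum_const_zero]

theorem cornerSum_partitionMatrix (μ : YoungDiagram) {m n : ℕ} (p : Fin m × Fin n) :
    cornerSum (partitionMatrix μ m n) p = if ((p.1 : ℕ), (p.2 : ℕ)) ∈ μ then 0 else 1 := by
  simp only [cornerSum_apply, sum_Iic_partitionMatrix]
  rw [sum_Iic_sub_pred fun k => if μ.rowLen k ≤ p.2 then (1 : ℝ) else 0]
  simp only [YoungDiagram.mem_iff_lt_rowLen, ← not_lt, ite_not]

theorem transpose_partitionMatrix (μ : YoungDiagram) (m n : ℕ) :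
    (partitionMatrix μ m n)ᵀ = partitionMatrix μ.transpose n m := by
  apply cornerSum_injective
  funext p
  simp only [cornerSum_transpose, cornerSum_partitionMatrix, YoungDiagram.mem_transpose,
    Prod.fst_swap, Prod.snd_swap, Prod.swap_prod_mk]

theorem finite_setOf_partitionMatrix (ν lam : YoungDiagram) (m n : ℕ) :
    {M | ∃ μ : YoungDiagram, lam ≤ μ ∧ μ ≤ ν ∧ M = partitionMatrix μ m n}.Finite := by
  have hcells : Function.Injective YoungDiagram.cells := fun _ _ => YoungDiagram.ext
  have hle : {μ : YoungDiagram | μ ≤ ν}.Finite := (Set.finite_Iic ν.cells).preimage hcells.injOn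
  refine (hle.image fun μ => partitionMatrix μ m n).subset ?_
  rintro _ ⟨μ, -, hμ, rfl⟩
  exact ⟨μ, hμ, rfl⟩

theorem isIntegerPolytope_PASMPolytope (ν lam : YoungDiagram) (m n : ℕ) :
    IsIntegerPolytope (PASMPolytope ν lam m n) := by
  refine ⟨_, finite_setOf_partitionMatrix ν lam m n, ?_, rfl⟩
  rintro _ ⟨μ, -, -, rfl⟩
  exact partitionMatrix_mem_integerMatrices μ m n

/-! ### Averaging over superlevel sets -/

section Superlevel

open MeasureTheory

theorem integrableOn_Ioc_ite_le (x : ℝ) :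
    IntegrableOn (fun t => if t ≤ x then (1 : ℝ) else 0) (Set.Ioc 0 1) :=
  (integrable_const (1 : ℝ)).indicator (measurableSet_Iic (a := x))

theorem setIntegral_Ioc_ite_le {x : ℝ} (hx : x ∈ Set.Icc 0 1) :
    ∫ t in Set.Ioc (0 : ℝ) 1, (if t ≤ x then (1 : ℝ) else 0) = x := by
  change ∫ t in Set.Ioc (0 : ℝ) 1, (Set.Iic x).indicator (fun _ => (1 : ℝ)) t = x
  rw [setIntegral_indicator measurableSet_Iic, Set.Ioc_inter_Iic, min_eq_right hx.2]
  simp [hx.1]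

theorem mem_convexHull_indicator_superlevel {ι : Type*} [Finite ι] {g : ι → ℝ}
    (hg : ∀ x, g x ∈ Set.Icc 0 1) :
    g ∈ convexHull ℝ ((fun t => {x | t ≤ g x}.indicator 1) '' Set.Ioc (0 : ℝ) 1) := by
  have := Fintype.ofFinite ι
  set f : ℝ → ι → ℝ := fun t => {x | t ≤ g x}.indicator 1
  have : IsProbabilityMeasure (volume.restrict (Set.Ioc (0 : ℝ) 1)) := ⟨by simp⟩
  have hint (x : ι) : IntegrableOn (fun t => f t x) (Set.Ioc 0 1) := integrableOn_Ioc_ite_le (g x)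
  have hfinite : (f '' Set.Ioc 0 1).Finite := by
    refine (Set.finite_range fun s : Set ι => s.indicator (1 : ι → ℝ)).subset ?_
    rintro _ ⟨t, -, rfl⟩
    exact ⟨_, rfl⟩
  have haverage : ∫ t in Set.Ioc (0 : ℝ) 1, f t = g := by
    funext x
    rw [eval_integral hint]
    exact setIntegral_Ioc_ite_le (hg x)
  rw [← haverage]
  exact (convex_convexHull ℝ _).integral_mem (hfinite.isClosed_convexHull ℝ)
    (ae_restrict_of_forall_mem measurableSet_Ioc fun t ht =>
      subset_convexHull ℝ _ (Set.mem_image_of_mem f ht))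
    (Integrable.of_eval hint)

end Superlevel

open Classical in
/-- The largest partition contained in `ν` all of whose boxes `p` in the `m × n` rectangle satisfy
`g p < t`. The condition is imposed on all boxes to the upper left of a given box, which yields a
lower set without any assumption on `g`. -/
noncomputable def sublevelDiagram {m n : ℕ} (ν : YoungDiagram) (g : Fin m × Fin n → ℝ) (t : ℝ) :
    YoungDiagram where
  cells := {c ∈ ν.cells | ∀ p : Fin m × Fin n, (p.1 : ℕ) ≤ c.1 → (p.2 : ℕ) ≤ c.2 → g p < t}
  isLowerSet := by
    intro c d hdc hc
    simp only [coe_filter, Set.mem_ofPred_eq] at hc ⊢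
    exact ⟨ν.isLowerSet hdc hc.1, fun p h1 h2 => hc.2 p (h1.trans hdc.1) (h2.trans hdc.2)⟩

section SublevelDiagram

variable {m n : ℕ} {ν lam : YoungDiagram} {g : Fin m × Fin n → ℝ} {t : ℝ}

theorem mem_sublevelDiagram {c : ℕ × ℕ} :
    c ∈ sublevelDiagram ν g t ↔
      c ∈ ν ∧ ∀ p : Fin m × Fin n, (p.1 : ℕ) ≤ c.1 → (p.2 : ℕ) ≤ c.2 → g p < t := by
  rw [← YoungDiagram.mem_cells, sublevelDiagram]
  simp only [mem_filter, YoungDiagram.mem_cells]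

theorem sublevelDiagram_le : sublevelDiagram ν g t ≤ ν :=
  fun _ hc => (mem_sublevelDiagram.1 hc).1

theorem le_sublevelDiagram (hle : lam ≤ ν)
    (hlam : ∀ p : Fin m × Fin n, ((p.1 : ℕ), (p.2 : ℕ)) ∈ lam → g p < t) :
    lam ≤ sublevelDiagram ν g t :=
  fun _ hc => mem_sublevelDiagram.2 ⟨hle hc, fun p h1 h2 => hlam p (lam.up_left_mem h1 h2 hc)⟩

theorem coe_mem_sublevelDiagram (hg : Monotone g)
    (hν : ∀ p : Fin m × Fin n, ((p.1 : ℕ), (p.2 : ℕ)) ∉ ν → t ≤ g p) (p : Fin m × Fin n) :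
    ((p.1 : ℕ), (p.2 : ℕ)) ∈ sublevelDiagram ν g t ↔ g p < t := by
  refine ⟨fun hp => (mem_sublevelDiagram.1 hp).2 p le_rfl le_rfl, fun hp =>
    mem_sublevelDiagram.2 ⟨?_, fun q h1 h2 => (hg (show q ≤ p from ⟨h1, h2⟩)).trans_lt hp⟩⟩
  by_contra h
  exact (hν p h).not_gt hp

end SublevelDiagram

theorem mem_PASMPolytope_of_cornerSum {m n : ℕ} {ν lam : YoungDiagram} (hle : lam ≤ ν)
    {M : Matrix (Fin m) (Fin n) ℝ} (hmono : Monotone (cornerSum M))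
    (hmem : ∀ p, cornerSum M p ∈ Set.Icc 0 1)
    (hlam : ∀ p : Fin m × Fin n, ((p.1 : ℕ), (p.2 : ℕ)) ∈ lam → cornerSum M p = 0)
    (hν : ∀ p : Fin m × Fin n, ((p.1 : ℕ), (p.2 : ℕ)) ∉ ν → cornerSum M p = 1) :
    M ∈ PASMPolytope ν lam m n := by
  have hhull : cornerSum M ∈ cornerSum '' PASMPolytope ν lam m n := by
    rw [PASMPolytope, cornerSum.image_convexHull]
    refine convexHull_mono ?_ (mem_convexHull_indicator_superlevel hmem)
    rintro _ ⟨t, ⟨ht0, ht1⟩, rfl⟩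
    refine ⟨_, ⟨sublevelDiagram ν (cornerSum M) t,
      le_sublevelDiagram hle fun p hp => (hlam p hp).trans_lt ht0, sublevelDiagram_le, rfl⟩, ?_⟩
    funext p
    rw [cornerSum_partitionMatrix]
    simp only [coe_mem_sublevelDiagram hmono fun p hp => ht1.trans_eq (hν p hp).symm,
      Set.indicator_apply, Set.mem_ofPred_eq, Pi.one_apply, ← not_le, ite_not]
  exact cornerSum_injective.mem_set_image.1 hhull

/-! ### The alternating sign matrix polytope -/

section ASMPolytope

variable {n : ℕ} {A : Matrix (Fin n) (Fin n) ℝ}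

theorem IsASM.transpose (hA : IsASM A) : IsASM Aᵀ where
  entry i j := hA.entry j i
  colPartial i j := hA.rowPartial j i
  rowPartial i j := hA.colPartial j i
  colSum := hA.rowSum
  rowSum := hA.colSum

theorem transpose_mem_ASMPolytope (hA : A ∈ ASMPolytope n) : Aᵀ ∈ ASMPolytope n :=
  convexHull_min (t := (·ᵀ) ⁻¹' ASMPolytope n)
    (fun M (hM : IsASM M) => subset_convexHull ℝ _ hM.transpose)
    ((convex_convexHull ℝ _).linear_preimage
      (Matrix.transposeLinearEquiv (Fin n) (Fin n) ℝ ℝ).toLinearMap) hA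

theorem sum_row_Iic_nonneg_of_mem_ASMPolytope (hA : A ∈ ASMPolytope n) (i j : Fin n) :
    0 ≤ ∑ j' ∈ Iic j, A i j' := by
  have hlinear : IsLinearMap ℝ fun A : Matrix (Fin n) (Fin n) ℝ => ∑ j' ∈ Iic j, A i j' :=
    ⟨fun _ _ => sum_add_distrib, fun _ _ => (mul_sum _ _ _).symm⟩
  refine convexHull_min (fun M hM => ?_) (convex_halfSpace_ge hlinear 0) hA
  rcases hM.rowPartial i j with h | h
  · exact h.ge
  · exact zero_le_one.trans_eq h.symm

theorem sum_row_eq_one_of_mem_ASMPolytope (hA : A ∈ ASMPolytope n) (i : Fin n) :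
    ∑ j, A i j = 1 := by
  have hlinear : IsLinearMap ℝ fun A : Matrix (Fin n) (Fin n) ℝ => ∑ j, A i j :=
    ⟨fun _ _ => sum_add_distrib, fun _ _ => (mul_sum _ _ _).symm⟩
  exact convexHull_min (fun M hM => hM.rowSum i) (convex_hyperplane hlinear 1) hA

theorem cornerSum_mono_of_mem_ASMPolytope (hA : A ∈ ASMPolytope n) : Monotone (cornerSum A) :=
  cornerSum_mono (sum_row_Iic_nonneg_of_mem_ASMPolytope hA) fun i j =>
    sum_row_Iic_nonneg_of_mem_ASMPolytope (transpose_mem_ASMPolytope hA) j i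

theorem cornerSum_nonneg_of_mem_ASMPolytope (hA : A ∈ ASMPolytope n) (p : Fin n × Fin n) :
    0 ≤ cornerSum A p :=
  cornerSum_nonneg (sum_row_Iic_nonneg_of_mem_ASMPolytope hA) p

theorem convex_ASMCRYPolytope (lam : YoungDiagram) (n : ℕ) : Convex ℝ (ASMCRYPolytope lam n) := by
  intro A hA B hB a b ha hb hab
  refine ⟨convex_convexHull ℝ _ hA.1 hB.1 ha hb hab, fun i j hij => ?_⟩
  simp only [Matrix.add_apply, Matrix.smul_apply, hA.2 i j hij, hB.2 i j hij, smul_zero, add_zero]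

theorem cornerSum_eq_zero_of_mem_ASMCRYPolytope {lam : YoungDiagram} (hA : A ∈ ASMCRYPolytope lam n)
    {p : Fin n × Fin n} (hp : ((p.1 : ℕ), (p.2 : ℕ)) ∈ lam) : cornerSum A p = 0 :=
  sum_eq_zero fun _ hi => sum_eq_zero fun _ hj =>
    hA.2 _ _ <| Or.inr <|
      lam.up_left_mem (Fin.le_def.1 (mem_Iic.1 hi)) (Fin.le_def.1 (mem_Iic.1 hj)) hp

theorem cornerSum_of_mem_ASMCRYPolytope {lam : YoungDiagram} (hA : A ∈ ASMCRYPolytope lam n)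
    {i j : Fin n} (hij : n ≤ i + j + 1) : cornerSum A (i, j) = (i + 1 : ℝ) + (j + 1) - n := by
  refine cornerSum_eq_of_forall_gt_eq_zero (sum_row_eq_one_of_mem_ASMPolytope hA.1)
    (sum_row_eq_one_of_mem_ASMPolytope (transpose_mem_ASMPolytope hA.1)) fun i' hi' j' hj' =>
    hA.2 i' j' (Or.inl ?_)
  simp only [gt_iff_lt, Fin.lt_def] at hi' hj'
  omega

theorem cornerSum_le_one_of_mem_ASMCRYPolytope {lam : YoungDiagram} (hA : A ∈ ASMCRYPolytope lam n)
    {i j : Fin n} (hij : i + j + 1 ≤ n) : cornerSum A (i, j) ≤ 1 := by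
  let j' : Fin n := ⟨n - 1 - i, by omega⟩
  have hj' : (i : ℕ) + j' + 1 = n := by
    simp only [j']
    omega
  have hle : j ≤ j' := Fin.le_def.2 (by omega)
  calc cornerSum A (i, j)
      ≤ cornerSum A (i, j') :=
        cornerSum_mono_of_mem_ASMPolytope hA.1 ⟨le_rfl, hle⟩
    _ = (i + 1 : ℝ) + (j' + 1) - n := cornerSum_of_mem_ASMCRYPolytope hA hj'.ge
    _ = 1 := by
        have hcast : (i : ℝ) + j' + 1 = n := mod_cast hj'
        linarith

end ASMPolytope

/-! ### The translation -/

section Translation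

variable {n : ℕ}

theorem antidiagonalTranslation_apply (M : Matrix (Fin n) (Fin n) ℝ) (i j : Fin n) :
    antidiagonalTranslation n M i j = M i j + if (j : ℕ) = n - i then 1 else 0 := by
  have hiff : (i : ℕ) + j = n ↔ (j : ℕ) = n - i := by omega
  change (if (i : ℕ) + j = n then M i j + 1 else M i j) = _
  simp only [hiff]
  split_ifs
  · rfl
  · rw [add_zero]

theorem transpose_antidiagonalTranslation (M : Matrix (Fin n) (Fin n) ℝ) :
    (antidiagonalTranslation n M)ᵀ = antidiagonalTranslation n Mᵀ := by
  ext i j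
  have hiff : (i : ℕ) = n - j ↔ (j : ℕ) = n - i := by omega
  simp only [Matrix.transpose_apply, antidiagonalTranslation_apply, hiff]

theorem antidiagonalTranslation_bijective (n : ℕ) :
    Function.Bijective (antidiagonalTranslation n) := by
  constructor
  · intro M N h
    ext i j
    have hij := congrFun (congrFun h i) j
    rw [antidiagonalTranslation_apply, antidiagonalTranslation_apply] at hij
    exact add_right_cancel hij
  · intro A
    refine ⟨Matrix.of fun i j => A i j - if (j : ℕ) = n - i then 1 else 0, ?_⟩
    ext i j
    rw [antidiagonalTranslation_apply, Matrix.of_apply, sub_add_cancel]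

theorem antidiagonalTranslation_mem_integerMatrices (M : Matrix (Fin n) (Fin n) ℝ) :
    antidiagonalTranslation n M ∈ integerMatrices n n ↔ M ∈ integerMatrices n n := by
  refine forall₂_congr fun i j => ?_
  rw [antidiagonalTranslation_apply]
  split_ifs
  · exact ⟨fun ⟨z, hz⟩ => ⟨z - 1, by push_cast; linarith⟩,
      fun ⟨z, hz⟩ => ⟨z + 1, by push_cast; linarith⟩⟩
  · rw [add_zero]

theorem cornerSum_antidiagonalTranslation (M : Matrix (Fin n) (Fin n) ℝ) (i j : Fin n) :
    cornerSum (antidiagonalTranslation n M) (i, j) =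
      cornerSum M (i, j) + ((i + j + 1 - n : ℕ) : ℝ) := by
  have hcount : #{k ∈ range (i + 1) | n - k ≤ (j : ℕ)} = i + j + 1 - n := by
    have hIco : {k ∈ range (i + 1) | n - k ≤ (j : ℕ)} = Ico (n - j) (i + 1 : ℕ) := by
      ext k
      simp only [mem_filter, mem_range, mem_Ico]
      omega
    rw [hIco, Nat.card_Ico]
    omega
  simp only [cornerSum_apply, antidiagonalTranslation_apply, sum_add_distrib, sum_Iic_ite_val_eq]
  rw [sum_Iic_val fun k => if n - k ≤ (j : ℕ) then (1 : ℝ) else 0, sum_boole, hcount]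

theorem transpose_staircase (n : ℕ) : (staircase n).transpose = staircase n := by
  refine SetLike.ext fun ⟨i, j⟩ => ?_
  rw [YoungDiagram.mem_transpose, Prod.swap_prod_mk, mem_staircase, mem_staircase, add_comm j i]

variable {μ : YoungDiagram}

theorem rowLen_add_lt_of_le_staircase (hμ : μ ≤ staircase n) {i : ℕ} (hi : i < n) :
    μ.rowLen i + i < n := by
  by_contra! h
  have hmem : (i, n - 1 - i) ∈ μ := YoungDiagram.mem_iff_lt_rowLen.2 (by omega)
  have := mem_staircase.1 (hμ hmem)
  omega

theorem entry_antidiagonalTranslation_partitionMatrix (hμ : μ ≤ staircase n) (i j : Fin n) :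
    antidiagonalTranslation n (partitionMatrix μ n n) i j ∈ ({-1, 0, 1} : Set ℝ) := by
  have hlast := rowLen_add_lt_of_le_staircase hμ i.2
  rw [antidiagonalTranslation_apply, partitionMatrix_apply]
  split_ifs <;> first | omega | norm_num

theorem sum_Iic_antidiagonalTranslation_partitionMatrix (hμ : μ ≤ staircase n) (i j : Fin n) :
    ∑ j' ∈ Iic j, antidiagonalTranslation n (partitionMatrix μ n n) i j' ∈ ({0, 1} : Set ℝ) := by
  have hanti := μ.rowLen_anti (i - 1) i (Nat.sub_le _ _)
  have hlast := rowLen_add_lt_of_le_staircase hμ (i := i - 1) (by omega)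
  simp only [antidiagonalTranslation_apply, sum_add_distrib, sum_Iic_partitionMatrix,
    sum_Iic_ite_val_eq]
  split_ifs <;> first | omega | norm_num

theorem sum_antidiagonalTranslation_partitionMatrix (hμ : μ ≤ staircase n) (i : Fin n) :
    ∑ j, antidiagonalTranslation n (partitionMatrix μ n n) i j = 1 := by
  have hrow := rowLen_add_lt_of_le_staircase hμ i.2
  have hprev := rowLen_add_lt_of_le_staircase hμ (i := i - 1) (by omega)
  simp only [antidiagonalTranslation_apply, sum_add_distrib, sum_partitionMatrix,
    sum_univ_ite_val_eq]
  split_ifs <;> first | omega | norm_num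

theorem isASM_antidiagonalTranslation_partitionMatrix (hμ : μ ≤ staircase n) :
    IsASM (antidiagonalTranslation n (partitionMatrix μ n n)) := by
  have hμt : μ.transpose ≤ staircase n := by
    simpa only [transpose_staircase] using YoungDiagram.transpose_mono hμ
  have htranspose (i j : Fin n) : antidiagonalTranslation n (partitionMatrix μ n n) i j =
      antidiagonalTranslation n (partitionMatrix μ.transpose n n) j i := by
    rw [← transpose_partitionMatrix, ← transpose_antidiagonalTranslation, Matrix.transpose_apply]
  exact
    { entry := entry_antidiagonalTranslation_partitionMatrix hμ
      rowPartial := sum_Iic_antidiagonalTranslation_partitionMatrix hμ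
      rowSum := sum_antidiagonalTranslation_partitionMatrix hμ
      colPartial := fun i j => by
        simpa only [htranspose] using sum_Iic_antidiagonalTranslation_partitionMatrix hμt j i
      colSum := fun j => by
        simpa only [htranspose] using sum_antidiagonalTranslation_partitionMatrix hμt j }

variable {lam : YoungDiagram}

theorem antidiagonalTranslation_partitionMatrix_mem_ASMCRYPolytope (hlam : lam ≤ μ)
    (hμ : μ ≤ staircase n) :
    antidiagonalTranslation n (partitionMatrix μ n n) ∈ ASMCRYPolytope lam n := by
  refine ⟨subset_convexHull ℝ _ (isASM_antidiagonalTranslation_partitionMatrix hμ),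
    fun i j hij => ?_⟩
  have hanti := μ.rowLen_anti (i - 1) i (Nat.sub_le _ _)
  have hrow := rowLen_add_lt_of_le_staircase hμ i.2
  have hprev := rowLen_add_lt_of_le_staircase hμ (i := i - 1) (by omega)
  have hlt (h : ((i : ℕ), (j : ℕ)) ∈ lam) : (j : ℕ) < μ.rowLen i :=
    YoungDiagram.mem_iff_lt_rowLen.1 (hlam h)
  rw [antidiagonalTranslation_apply, partitionMatrix_apply]
  rcases hij with hij | hij
  · split_ifs <;> first | omega | norm_num
  · have := hlt hij
    split_ifs <;> first | omega | norm_num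

theorem mem_PASMPolytope_of_antidiagonalTranslation_mem (hlam : lam ≤ staircase n)
    {M : Matrix (Fin n) (Fin n) ℝ} (hM : antidiagonalTranslation n M ∈ ASMCRYPolytope lam n) :
    M ∈ PASMPolytope (staircase n) lam n n := by
  have hin (p : Fin n × Fin n) (hp : ((p.1 : ℕ), (p.2 : ℕ)) ∈ staircase n) :
      cornerSum M p = cornerSum (antidiagonalTranslation n M) p := by
    have := mem_staircase.1 hp
    rw [cornerSum_antidiagonalTranslation, Nat.sub_eq_zero_of_le (by omega), Nat.cast_zero,
      add_zero]
  have hout (p : Fin n × Fin n) (hp : ((p.1 : ℕ), (p.2 : ℕ)) ∉ staircase n) :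
      cornerSum M p = 1 := by
    rw [mem_staircase] at hp
    have hsum := cornerSum_of_mem_ASMCRYPolytope hM (i := p.1) (j := p.2) (by omega)
    rw [cornerSum_antidiagonalTranslation, Nat.cast_sub (by omega)] at hsum
    push_cast at hsum
    linarith
  have hIcc (p : Fin n × Fin n) : cornerSum M p ∈ Set.Icc 0 1 := by
    by_cases hp : ((p.1 : ℕ), (p.2 : ℕ)) ∈ staircase n
    · have := mem_staircase.1 hp
      rw [hin p hp]
      exact ⟨cornerSum_nonneg_of_mem_ASMPolytope hM.1 p,
        cornerSum_le_one_of_mem_ASMCRYPolytope hM (by omega)⟩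
    · rw [hout p hp]
      exact Set.right_mem_Icc.2 zero_le_one
  have hmono : Monotone (cornerSum M) := by
    intro p q hpq
    by_cases hq : ((q.1 : ℕ), (q.2 : ℕ)) ∈ staircase n
    · rw [hin q hq, hin p ((staircase n).up_left_mem hpq.1 hpq.2 hq)]
      exact cornerSum_mono_of_mem_ASMPolytope hM.1 hpq
    · exact (hIcc p).2.trans_eq (hout q hq).symm
  exact mem_PASMPolytope_of_cornerSum hlam hmono hIcc
    (fun p hp => (hin p (hlam hp)).trans (cornerSum_eq_zero_of_mem_ASMCRYPolytope hM hp)) hout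

theorem antidiagonalTranslation_image_PASMPolytope (hlam : lam ≤ staircase n) :
    antidiagonalTranslation n '' PASMPolytope (staircase n) lam n n = ASMCRYPolytope lam n := by
  apply Set.Subset.antisymm
  · rw [PASMPolytope, AffineMap.image_convexHull]
    refine convexHull_min ?_ (convex_ASMCRYPolytope lam n)
    rintro _ ⟨_, ⟨μ, hlamμ, hμ, rfl⟩, rfl⟩
    exact antidiagonalTranslation_partitionMatrix_mem_ASMCRYPolytope hlamμ hμ
  · intro A hA
    obtain ⟨M, rfl⟩ := (antidiagonalTranslation_bijective n).surjective A
    exact Set.mem_image_of_mem _ (mem_PASMPolytope_of_antidiagonalTranslation_mem hlam hA)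

end Translation

/-! ### Integral equivalences -/

section IntegralEquivalence

variable {m n m' n' : ℕ} {f : Matrix (Fin m) (Fin n) ℝ →ᵃ[ℝ] Matrix (Fin m') (Fin n') ℝ}
  {P : Set (Matrix (Fin m) (Fin n) ℝ)}

theorem IsIntegerPolytope.image (hP : IsIntegerPolytope P)
    (hf : Set.MapsTo f (integerMatrices m n) (integerMatrices m' n')) :
    IsIntegerPolytope (f '' P) := by
  obtain ⟨V, hfinite, hinteger, rfl⟩ := hP
  exact ⟨f '' V, hfinite.image f, (hf.mono_left hinteger).image_subset, f.image_convexHull V⟩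

theorem IsIntegerPolytope.isIntegralEquivalence_image (hP : IsIntegerPolytope P)
    (hinj : Function.Injective f)
    (hf : ∀ M, f M ∈ integerMatrices m' n' ↔ M ∈ integerMatrices m n) :
    IsIntegralEquivalence f P (f '' P) where
  source_integer := hP
  target_integer := hP.image fun M => (hf M).2
  bijOn := hinj.injOn.bijOn_image
  bijOn_lattice := by
    rw [← AffineSubspace.map_span, AffineSubspace.coe_map]
    convert hinj.injOn.bijOn_image using 1
    ext A
    constructor
    · rintro ⟨hA, M, hM, rfl⟩
      exact ⟨M, ⟨(hf M).1 hA, hM⟩, rfl⟩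
    · rintro ⟨M, ⟨hM, hspan⟩, rfl⟩
      exact ⟨(hf M).2 hM, M, hspan, rfl⟩

end IntegralEquivalence

end Development

theorem mainTheorem6 (n : ℕ) (hn : 0 < n) (lam : YoungDiagram) (hlam : lam ≤ staircase n) :
    IsIntegralEquivalence (antidiagonalTranslation n)
      (PASMPolytope (staircase n) lam n n) (ASMCRYPolytope lam n) := by
  rw [← antidiagonalTranslation_image_PASMPolytope hlam]
  exact (isIntegerPolytope_PASMPolytope (staircase n) lam n n).isIntegralEquivalence_image
    (antidiagonalTranslation_bijective n).injective antidiagonalTranslation_mem_integerMatrices
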